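/- Let $F$ be a finite field with $q$ elements, $\operatorname{char} F\neq 2$, let $E$ be its quadratic extension with norm $N$, trace $\mathrm{Tr}$ and conjugation $\bar z=z^q$, and let $U=\{u\in E^\times : N(u)=1\}$. Let $G=\mathrm{GL}(2,F)$ and let $K\subset G$ be the Coxeter torus, i.e. the group of matrices of the maps $w\mapsto zw$ $(z\in E^\times)$ in an $F$-basis $(1,\delta)$ of $E$ with $\mathrm{Tr}(\delta)=0$. Let $\Lambda$ be a complex character of $E^\times$ with $\Lambda^q\neq\Lambda$ whose restriction to $F^\times$ is trivial, let $\chi_\Lambda$ be the character of the $(q-1)$-dimensional cuspidal representation of $G$ attached to $\Lambda$, and let $$\zeta_\Lambda(g)=\frac1{|K|}\sum_{k\in K}\chi_\Lambda(kg)\qquad(g\in G)$$ be the corresponding spherical function for $\Phi=\mathbf 1$. Write $\zeta_\Lambda(a)=\zeta_\Lambda\left(\begin{pmatrix}a&0\\0&1\end{pmatrix}\right)$ for $a\in F^\times$. Then there is a unique character $\omega$ of $U$ with $\Lambda(z)=\omega(z/\bar z)$ for all $z\in E^\times$, and for every $a\in F^\times$ with $a\neq 1$ and $a\neq -1$, $$\zeta_\Lambda(a)=(q+1)^{-1}\sum_{u\in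 U}\varepsilon\bigl(\mathrm{Tr}(u)-(a+a^{-1})\bigr)\,(\varepsilon\omega)(u).$$ Here, on $F$, $\varepsilon$ is the sign (quadratic) character of $F^\times$, extended by $\varepsilon(0)=0$, and in the factor $(\varepsilon\omega)(u)=\varepsilon(u)\omega(u)$, $\varepsilon$ is the sign character of the cyclic group $U$, i.e. its character of order two. -/

import Mathlib

open scoped MatrixGroups

set_option linter.unusedSectionVars false

namespace FinitePoincare

section Fields

variable {F E : Type*} [Field F] [Fintype F] [DecidableEq F]
  [Field E] [Fintype E] [DecidableEq E] [Algebra F E]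

/-- The trace form of the quadratic extension: `N (s + t) = N s + Tr (s * t̄) + N t`,
where `t̄ = t ^ q`. -/
theorem norm_add_eq (hE : Module.finrank F E = 2) (s t : E) :
    Algebra.norm F (s + t) = Algebra.norm F s
      + Algebra.trace F E (s * t ^ Fintype.card F) + Algebra.norm F t := by
  apply (algebraMap F E).injective
  simp only [map_add, FiniteField.algebraMap_norm_eq_prod_pow,
    FiniteField.algebraMap_trace_eq_sum_pow, hE, Finset.prod_range_succ, Finset.prod_range_zero,
    Finset.sum_range_succ, Finset.sum_range_zero, Nat.card_eq_fintype_card, pow_zero, pow_one]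
  have h1 : (s + t) ^ Fintype.card F = s ^ Fintype.card F + t ^ Fintype.card F := by
    simpa using map_add (FiniteField.frobeniusAlgHom F E) s t
  have h2 : (t ^ Fintype.card F) ^ Fintype.card F = t := by
    rw [← pow_mul, ← pow_two, ← hE, ← Module.card_eq_pow_finrank (K := F), FiniteField.pow_card]
  rw [h1, mul_pow, h2]
  ring

theorem conj_conj (hE : Module.finrank F E = 2) (t : E) :
    (t ^ Fintype.card F) ^ Fintype.card F = t := by
  rw [← pow_mul, ← pow_two, ← hE, ← Module.card_eq_pow_finrank (K := F), FiniteField.pow_card]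

theorem norm_conj (t : E) :
    Algebra.norm F (t ^ Fintype.card F) = Algebra.norm F t := by
  rw [map_pow, FiniteField.pow_card]

theorem trace_conj (hE : Module.finrank F E = 2) (t : E) :
    Algebra.trace F E (t ^ Fintype.card F) = Algebra.trace F E t := by
  apply (algebraMap F E).injective
  simp only [FiniteField.algebraMap_trace_eq_sum_pow, hE,
    Finset.sum_range_succ, Finset.sum_range_zero, Nat.card_eq_fintype_card, pow_zero, pow_one,
    conj_conj hE]
  ring

/-- The elements of `Eˣ` of norm `n`. -/
noncomputable def normFibre (n : F) : Finset Eˣ :=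
  Finset.univ.filter fun t : Eˣ => Algebra.norm F (t : E) = n

theorem mem_normFibre {n : F} {t : Eˣ} :
    t ∈ normFibre (E := E) n ↔ Algebra.norm F (t : E) = n := by
  simp [normFibre]

/-- A character of `E` that is not fixed by Frobenius sums to zero on the fibres of the norm. -/
theorem sum_norm_fibre_eq_zero {Λ : MulChar E ℂ} (hΛ : Λ ^ Fintype.card F ≠ Λ) (n : F) :
    ∑ r ∈ normFibre (E := E) n, Λ r = 0 := by
  obtain ⟨z, hz⟩ : ∃ z : Eˣ, Λ (z ^ Fintype.card F : E) ≠ Λ z := by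
    by_contra! h
    apply hΛ
    ext z
    rw [← h z, MulChar.pow_apply_coe, map_pow]
  set u : Eˣ := z ^ Fintype.card F / z with hu
  have hNu : Algebra.norm F (u : E) = 1 := by
    have : (u : E) * z = (z : E) ^ Fintype.card F := by simp [hu]
    have h2 := congrArg (Algebra.norm F) this
    rw [norm_conj, map_mul] at h2
    exact mul_eq_right₀ (Algebra.norm_ne_zero_iff.2 z.ne_zero) |>.1 h2
  have hNu' : Algebra.norm F ((u⁻¹ : Eˣ) : E) = 1 := by
    have h2 : Algebra.norm F (((u⁻¹ : Eˣ) : E) * u) = 1 := by simp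
    rwa [map_mul, hNu, mul_one] at h2
  have hΛu : Λ u ≠ 1 := by
    intro h
    apply hz
    have : (u : E) * z = (z : E) ^ Fintype.card F := by simp [hu]
    rw [← this, map_mul, h, one_mul]
  have key : ∑ r ∈ normFibre (E := E) n, Λ r
      = Λ u * ∑ r ∈ normFibre (E := E) n, Λ r := by
    rw [Finset.mul_sum]
    symm
    refine Finset.sum_nbij' (fun r => u * r) (fun r => u⁻¹ * r) ?_ ?_ ?_ ?_ ?_
    · intro r hr
      rw [mem_normFibre] at hr ⊢; rw [Units.val_mul, map_mul, hNu, one_mul, hr]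
    · intro r hr
      rw [mem_normFibre] at hr ⊢; rw [Units.val_mul, map_mul, hNu', one_mul, hr]
    · intro r _; simp
    · intro r _; simp
    · intro r _; simp
  by_contra h0
  exact hΛu (mul_right_cancel₀ h0 (by rw [one_mul]; exact key.symm))

/-- The Gauss sum of the norm form. -/
theorem sum_norm_form (hE : Module.finrank F E = 2) {ψ : AddChar F ℂ} (hψ : ψ ≠ 1) {α : F}
    (hα : α ≠ 0) : ∑ s : E, ψ (α * Algebra.norm F s) = -(Fintype.card F : ℂ) := by
  have hcE : (Fintype.card E : ℂ) = (Fintype.card F : ℂ) ^ 2 := by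
    rw [Module.card_eq_pow_finrank (K := F) (V := E), hE]; push_cast; rfl
  have hconst : ∀ α : F, α ≠ 0 →
      ∑ s : E, ψ (α * Algebra.norm F s) = ∑ s : E, ψ (Algebra.norm F s) := by
    intro α hα
    obtain ⟨γ, hγ⟩ := FiniteField.norm_surjective F E α
    have hγ0 : γ ≠ 0 := by
      rintro rfl
      exact hα (by rw [← hγ, Algebra.norm_zero])
    refine Fintype.sum_equiv (Equiv.mulLeft₀ γ hγ0) _ _ fun s => ?_
    simp [hγ]
  have htot : ∑ α : F, ∑ s : E, ψ (α * Algebra.norm F s) = (Fintype.card F : ℂ) := by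
    rw [Finset.sum_comm]
    have : ∀ s : E, ∑ α : F, ψ (α * Algebra.norm F s)
        = if s = 0 then (Fintype.card F : ℂ) else 0 := by
      intro s
      rw [AddChar.sum_mulShift _ (AddChar.IsPrimitive.of_ne_one hψ)]
      simp [Algebra.norm_eq_zero_iff]
    simp [this]
  have hsplit : ∑ α : F, ∑ s : E, ψ (α * Algebra.norm F s)
      = (Fintype.card F : ℂ) ^ 2
        + ((Fintype.card F : ℂ) - 1) * ∑ s : E, ψ (Algebra.norm F s) := by
    rw [← Finset.add_sum_erase _ _ (Finset.mem_univ (0 : F)),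
      Finset.sum_congr rfl fun α hα => hconst α (Finset.ne_of_mem_erase hα)]
    simp [hcE, Finset.card_erase_of_mem, Nat.cast_sub Fintype.card_pos]
  rw [hconst α hα]
  have hq : (Fintype.card F : ℂ) - 1 ≠ 0 := by
    rw [sub_ne_zero]
    exact_mod_cast (Fintype.one_lt_card (α := F)).ne'
  apply mul_left_cancel₀ hq
  linear_combination hsplit.symm.trans htot

/-- The quadratic Gauss sum obtained from the norm form by completing the square. -/
theorem sum_norm_trace (hE : Module.finrank F E = 2) {ψ : AddChar F ℂ} (hψ : ψ ≠ 1) {α : F}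
    (hα : α ≠ 0) (β : E) :
    ∑ s : E, ψ (α * Algebra.norm F s + Algebra.trace F E (s * β))
      = -(Fintype.card F : ℂ) * ψ (-(Algebra.norm F β / α)) := by
  rw [← sum_norm_form hE hψ hα, Finset.sum_mul]
  set γ : E := algebraMap F E α⁻¹ * β ^ Fintype.card F with hγ
  refine Fintype.sum_equiv (Equiv.addRight γ) _ _ fun s => ?_
  rw [← AddChar.map_add_eq_mul]
  congr 1
  have h1 : γ ^ Fintype.card F = algebraMap F E α⁻¹ * β := by
    rw [hγ, mul_pow, conj_conj hE, ← map_pow, FiniteField.pow_card]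
  have h2 : Algebra.norm F γ = α⁻¹ ^ 2 * Algebra.norm F β := by
    rw [hγ, map_mul, norm_conj, Algebra.norm_algebraMap, hE]
  have h3 : s * (algebraMap F E α⁻¹ * β) = α⁻¹ • (s * β) := by
    rw [Algebra.smul_def]; ring
  rw [Equiv.coe_addRight, norm_add_eq hE, h1, h2, h3, map_smul, smul_eq_mul]
  field_simp
  ring

theorem sum_trace (hE : Module.finrank F E = 2) {ψ : AddChar F ℂ} (hψ : ψ ≠ 1) (β : E) :
    ∑ s : E, ψ (Algebra.trace F E (s * β))
      = if β = 0 then (Fintype.card F : ℂ) ^ 2 else 0 := by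
  have hcE : (Fintype.card E : ℂ) = (Fintype.card F : ℂ) ^ 2 := by
    rw [Module.card_eq_pow_finrank (K := F) (V := E), hE]; push_cast; rfl
  split_ifs with hβ
  · simp [hβ, hcE]
  · have hψ' : ψ.compAddMonoidHom (Algebra.trace F E).toAddMonoidHom ≠ 1 := by
      intro h
      apply hψ
      ext x
      obtain ⟨y, rfl⟩ := Algebra.trace_surjective F E x
      simpa using DFunLike.congr_fun h y
    rw [← AddChar.sum_eq_zero_of_ne_one hψ']
    refine Fintype.sum_equiv (Equiv.mulRight₀ β hβ) _ _ fun s => ?_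
    simp

/-- Summing over `Eˣ` instead of `E`. -/
theorem sum_units (f : E → ℂ) : ∑ s : Eˣ, f s = ∑ s : E, f s - f 0 := by
  rw [← Finset.sum_erase_eq_sub (Finset.mem_univ (0 : E))]
  refine Finset.sum_bij (fun s _ => (s : E)) ?_ ?_ ?_ ?_
  · intro s _; simp
  · intro s _ t _ h; exact Units.ext h
  · intro s hs; exact ⟨Units.mk0 s (Finset.ne_of_mem_erase hs), Finset.mem_univ _, rfl⟩
  · intro s _; rfl

/-- Matrix coefficients, in the basis of point masses on `Fˣ`, of the operator by which
`(a, b; c, d)` acts in the Kirillov model of the cuspidal representation attached to `Λ`.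
For `c = 0` this is the operator `f ↦ (x ↦ Λ d * ψ (b * x / d) * f (a * x / d))`. -/
noncomputable def kirillovKernel (ψ : AddChar F ℂ) (Λ : MulChar E ℂ) (a b c d : F) :
    Matrix Fˣ Fˣ ℂ := fun x y =>
  if c = 0 then
    if a * x = d * y then Λ (algebraMap F E d) * ψ (b * x / d) else 0
  else
    -(Fintype.card F : ℂ)⁻¹ * ψ ((a * x + d * y) / c) *
      ∑ t ∈ normFibre (E := E) (x / y * (a * d - b * c)),
        Λ t * ψ (-(y / c * Algebra.trace F E (t : E)))

theorem kirillovKernel_one (ψ : AddChar F ℂ) (Λ : MulChar E ℂ) :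
    kirillovKernel ψ Λ 1 0 0 1 = 1 := by
  ext x y
  simp [kirillovKernel, Matrix.one_apply, Units.ext_iff]

/-- Rescaling a norm fibre by an element of `F`. -/
theorem sum_normFibre_smul (hE : Module.finrank F E = 2) {e : F} (he : e ≠ 0) {m n : F}
    (h : e ^ 2 * m = n) (f : E → ℂ) :
    ∑ t ∈ normFibre (E := E) n, f t = ∑ t ∈ normFibre (E := E) m, f (algebraMap F E e * t) := by
  subst h
  have he' : algebraMap F E e ≠ 0 := by simpa using he
  set u : Eˣ := Units.mk0 (algebraMap F E e) he' with hu
  have hN : Algebra.norm F (u : E) = e ^ 2 := by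
    rw [hu, Units.val_mk0, Algebra.norm_algebraMap, hE]
  symm
  refine Finset.sum_nbij' (fun t => u * t) (fun t => u⁻¹ * t) ?_ ?_ ?_ ?_ ?_
  · intro t ht
    rw [mem_normFibre] at ht ⊢
    rw [Units.val_mul, map_mul, hN, ht]
  · intro t ht
    rw [mem_normFibre] at ht ⊢
    apply mul_left_cancel₀ (pow_ne_zero 2 he)
    rw [← hN, ← map_mul, ← Units.val_mul, mul_inv_cancel_left, ht, hN]
  · intro t _; simp
  · intro t _; simp
  · intro t _; simp [hu]

theorem kirillovKernel_of_eq (ψ : AddChar F ℂ) (Λ : MulChar E ℂ) {a b c d : F} (hc : c = 0)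
    {x y : Fˣ} (h : a * x = d * y) :
    kirillovKernel ψ Λ a b c d x y = Λ (algebraMap F E d) * ψ (b * x / d) := by
  rw [kirillovKernel, if_pos hc, if_pos h]

theorem kirillovKernel_of_ne (ψ : AddChar F ℂ) (Λ : MulChar E ℂ) {a b c d : F} (hc : c = 0)
    {x y : Fˣ} (h : a * x ≠ d * y) : kirillovKernel ψ Λ a b c d x y = 0 := by
  rw [kirillovKernel, if_pos hc, if_neg h]

theorem kirillovKernel_of_ne_zero (ψ : AddChar F ℂ) (Λ : MulChar E ℂ) {a b c d : F} (hc : c ≠ 0)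
    (x y : Fˣ) :
    kirillovKernel ψ Λ a b c d x y = -(Fintype.card F : ℂ)⁻¹ * ψ ((a * x + d * y) / c) *
      ∑ t ∈ normFibre (E := E) (x / y * (a * d - b * c)),
        Λ t * ψ (-(y / c * Algebra.trace F E (t : E))) := by
  rw [kirillovKernel, if_neg hc]

theorem kirillovKernel_mul_upper_left (hE : Module.finrank F E = 2)
    (ψ : AddChar F ℂ) (Λ : MulChar E ℂ) {a b d : F}
    (ha : a ≠ 0) (hd : d ≠ 0) {a' b' c' d' : F} (h' : a' * d' - b' * c' ≠ 0) :
    kirillovKernel ψ Λ a b 0 d * kirillovKernel ψ Λ a' b' c' d'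
      = kirillovKernel ψ Λ (a * a' + b * c') (a * b' + b * d') (d * c') (d * d') := by
  ext x z
  obtain ⟨y, hy⟩ : ∃ y : Fˣ, a * (x : F) = d * y :=
    ⟨Units.mk0 (a * x / d) (div_ne_zero (mul_ne_zero ha x.ne_zero) hd), by
      rw [Units.val_mk0]; field_simp⟩
  have hx0 := x.ne_zero
  have hy0 := y.ne_zero
  have hz0 := z.ne_zero
  rw [Matrix.mul_apply, Finset.sum_eq_single y]
  rotate_left
  · intro y' _ hy'
    rw [kirillovKernel_of_ne ψ Λ rfl, zero_mul]
    intro h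
    exact hy' (Units.ext (mul_left_cancel₀ hd (h.symm.trans hy)))
  · simp
  rw [kirillovKernel_of_eq ψ Λ rfl hy]
  have hxy : (x : F) = d * y / a := by field_simp; linear_combination hy
  by_cases hc : c' = 0
  · subst hc
    have hd' : d' ≠ 0 := by rintro rfl; simp at h'
    by_cases h : a' * (y : F) = d' * z
    · rw [kirillovKernel_of_eq ψ Λ rfl h, kirillovKernel_of_eq ψ Λ (mul_zero d)
        (by linear_combination a' * hy + d * h), map_mul, map_mul, mul_mul_mul_comm,
        ← AddChar.map_add_eq_mul]
      congr 2
      rw [hxy]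
      field_simp
      ring
    · rw [kirillovKernel_of_ne ψ Λ rfl h, kirillovKernel_of_ne ψ Λ (mul_zero d), mul_zero]
      intro h3
      apply h
      apply mul_left_cancel₀ hd
      linear_combination h3 - a' * hy
  · rw [kirillovKernel_of_ne_zero ψ Λ hc, kirillovKernel_of_ne_zero ψ Λ (mul_ne_zero hd hc),
      sum_normFibre_smul hE hd (m := y / z * (a' * d' - b' * c'))
        (by rw [hxy]; field_simp; ring)
        (fun t => Λ t * ψ (-(z / (d * c') * Algebra.trace F E t)))]
    have hT : ∀ t : E, Λ (algebraMap F E d * t) *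
        ψ (-(z / (d * c') * Algebra.trace F E (algebraMap F E d * t)))
        = Λ (algebraMap F E d) * (Λ t * ψ (-(z / c' * Algebra.trace F E t))) := by
      intro t
      rw [map_mul, ← Algebra.smul_def, map_smul, smul_eq_mul, mul_assoc]
      congr 3
      field_simp
    simp only [hT]
    rw [← Finset.mul_sum]
    have hP : ψ (((a * a' + b * c') * x + d * d' * z) / (d * c'))
        = ψ (b * x / d) * ψ ((a' * y + d' * z) / c') := by
      rw [← AddChar.map_add_eq_mul]
      congr 1
      rw [hxy]
      field_simp
      ring
    rw [hP]
    ring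

theorem kirillovKernel_mul_upper_right (hE : Module.finrank F E = 2)
    (ψ : AddChar F ℂ) (Λ : MulChar E ℂ) {a b c d : F} (hc : c ≠ 0)
    {a' b' d' : F} (ha' : a' ≠ 0) (hd' : d' ≠ 0) :
    kirillovKernel ψ Λ a b c d * kirillovKernel ψ Λ a' b' 0 d'
      = kirillovKernel ψ Λ (a * a') (a * b' + b * d') (c * a') (c * b' + d * d') := by
  ext x z
  obtain ⟨y, hy⟩ : ∃ y : Fˣ, a' * (y : F) = d' * z :=
    ⟨Units.mk0 (d' * z / a') (div_ne_zero (mul_ne_zero hd' z.ne_zero) ha'), by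
      rw [Units.val_mk0]; field_simp⟩
  have hx0 := x.ne_zero
  have hy0 := y.ne_zero
  have hz0 := z.ne_zero
  rw [Matrix.mul_apply, Finset.sum_eq_single y]
  rotate_left
  · intro y' _ hy'
    rw [kirillovKernel_of_ne ψ Λ rfl (x := y'), mul_zero]
    intro h
    exact hy' (Units.ext (mul_left_cancel₀ ha' (h.trans hy.symm)))
  · simp
  have hyz : (y : F) = d' * z / a' := by field_simp; linear_combination hy
  rw [kirillovKernel_of_eq ψ Λ rfl hy, kirillovKernel_of_ne_zero ψ Λ hc,
    kirillovKernel_of_ne_zero ψ Λ (mul_ne_zero hc ha'),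
    sum_normFibre_smul hE hd' (m := x / y * (a * d - b * c))
      (by rw [hyz]; field_simp; ring)
      (fun t => Λ t * ψ (-(z / (c * a') * Algebra.trace F E t)))]
  have hT : ∀ t : E, Λ (algebraMap F E d' * t) *
      ψ (-(z / (c * a') * Algebra.trace F E (algebraMap F E d' * t)))
      = Λ (algebraMap F E d') * (Λ t * ψ (-(y / c * Algebra.trace F E t))) := by
    intro t
    rw [map_mul, ← Algebra.smul_def, map_smul, smul_eq_mul, mul_assoc]
    congr 3
    rw [hyz]
    field_simp
  simp only [hT]
  rw [← Finset.mul_sum]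
  have hP : ψ ((a * a' * x + (c * b' + d * d') * z) / (c * a'))
      = ψ ((a * x + d * y) / c) * ψ (b' * y / d') := by
    rw [← AddChar.map_add_eq_mul]
    congr 1
    rw [hyz]
    field_simp
    ring
  rw [hP]
  ring

theorem mul_conj (hE : Module.finrank F E = 2) (s : E) :
    s * s ^ Fintype.card F = algebraMap F E (Algebra.norm F s) := by
  simp [FiniteField.algebraMap_norm_eq_prod_pow, hE, Finset.prod_range_succ]

/-- The product of two kernels off the Borel subgroup, as a sum over `E`. -/
theorem kirillovKernel_mul_aux (hE : Module.finrank F E = 2)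
    (ψ : AddChar F ℂ) {Λ : MulChar E ℂ} (hΛ : Λ ^ Fintype.card F ≠ Λ) {a b c d : F} (hc : c ≠ 0)
    {a' b' c' d' : F} (hc' : c' ≠ 0) (h' : a' * d' - b' * c' ≠ 0) (x z : Fˣ) :
    (kirillovKernel ψ Λ a b c d * kirillovKernel ψ Λ a' b' c' d') x z
      = (Fintype.card F : ℂ)⁻¹ ^ 2 * ψ (a * x / c + d' * z / c') *
        ∑ r ∈ normFibre (E := E) (x / z * (a * d - b * c) * (a' * d' - b' * c')), Λ r *
          ∑ s : E, ψ ((c * a' + d * c') / (c * c') * z / (a' * d' - b' * c') * Algebra.norm F s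
            + Algebra.trace F E (s * (-(algebraMap F E (z / (c * (a' * d' - b' * c')))
                * (r : E) ^ Fintype.card F) - algebraMap F E (z / c')))) := by
  set D := a * d - b * c with hD
  set D' := a' * d' - b' * c' with hD'
  have hz0 := z.ne_zero
  set T : E → E → ℂ := fun r s => ψ ((c * a' + d * c') / (c * c') * z / D' * Algebra.norm F s
            + Algebra.trace F E (s * (-(algebraMap F E (z / (c * D'))
                * r ^ Fintype.card F) - algebraMap F E (z / c')))) with hT
  have h1 : ∑ r ∈ normFibre (E := E) (x / z * D * D'), Λ r * ∑ s : E, T r s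
      = ∑ r ∈ normFibre (E := E) (x / z * D * D'), ∑ s : Eˣ, Λ r * T r s := by
    have h0 : ∀ r : E, T r 0 = 1 := by intro r; simp [hT, Algebra.norm_zero]
    simp only [← Finset.mul_sum, sum_units, h0, mul_sub, mul_one, Finset.sum_sub_distrib,
      sum_norm_fibre_eq_zero hΛ, sub_zero]
  rw [h1, Matrix.mul_apply]
  simp only [kirillovKernel_of_ne_zero ψ Λ hc, kirillovKernel_of_ne_zero ψ Λ hc', ← hD, ← hD']
  have h2 : ∀ y : Fˣ, -(Fintype.card F : ℂ)⁻¹ * ψ ((a * x + d * y) / c) *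
      (∑ t ∈ normFibre (E := E) (x / y * D), Λ t * ψ (-(y / c * Algebra.trace F E (t : E)))) *
      (-(Fintype.card F : ℂ)⁻¹ * ψ ((a' * y + d' * z) / c') *
      ∑ s ∈ normFibre (E := E) (y / z * D'), Λ s * ψ (-(z / c' * Algebra.trace F E (s : E))))
      = (Fintype.card F : ℂ)⁻¹ ^ 2 *
        ∑ p ∈ normFibre (E := E) (x / y * D) ×ˢ normFibre (E := E) (y / z * D'),
          ψ ((a * x + d * y) / c) * ψ ((a' * y + d' * z) / c') *
          (Λ p.1 * ψ (-(y / c * Algebra.trace F E (p.1 : E))) *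
          (Λ p.2 * ψ (-(z / c' * Algebra.trace F E (p.2 : E))))) := by
    intro y
    rw [← Finset.mul_sum, Finset.sum_product]
    simp only [← Finset.sum_mul_sum]
    ring
  simp only [h2]
  rw [← Finset.mul_sum, mul_assoc, Finset.sum_sigma', ← Finset.sum_product']
  congr 1
  rw [Finset.mul_sum]
  have hj : ∀ s : Eˣ, (z : F) * Algebra.norm F (s : E) / D' ≠ 0 := fun s =>
    div_ne_zero (mul_ne_zero hz0 (Algebra.norm_ne_zero_iff.2 s.ne_zero)) h'
  refine Finset.sum_nbij' (fun w => (w.2.1 * w.2.2, w.2.2))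
    (fun w => ⟨Units.mk0 _ (hj w.2), (w.1 / w.2, w.2)⟩) ?_ ?_ ?_ ?_ ?_
  · rintro ⟨y, t, s⟩ hw
    simp only [Finset.mem_sigma, Finset.mem_product, mem_normFibre, Finset.mem_univ,
      true_and] at hw
    have hy0 := y.ne_zero
    simp only [Finset.mem_product, mem_normFibre, Finset.mem_univ, and_true, Units.val_mul,
      map_mul, hw.1, hw.2]
    field_simp
  · rintro ⟨r, s⟩ hw
    simp only [Finset.mem_product, mem_normFibre, Finset.mem_univ, and_true] at hw
    have hs : Algebra.norm F (s : E) ≠ 0 := Algebra.norm_ne_zero_iff.2 s.ne_zero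
    simp only [Finset.mem_sigma, Finset.mem_product, mem_normFibre, Finset.mem_univ,
      true_and, Units.val_mk0]
    constructor
    · apply mul_right_cancel₀ hs
      rw [← map_mul, ← Units.val_mul, div_mul_cancel, hw]
      field_simp
    · field_simp
  · rintro ⟨y, t, s⟩ hw
    simp only [Finset.mem_sigma, Finset.mem_product, mem_normFibre, Finset.mem_univ,
      true_and] at hw
    have : Units.mk0 _ (hj s) = y := by
      ext
      rw [Units.val_mk0, hw.2]
      field_simp
    simp [this]
  · rintro ⟨r, s⟩ hw
    simp
  · rintro ⟨y, t, s⟩ hw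
    simp only [Finset.mem_sigma, Finset.mem_product, mem_normFibre, Finset.mem_univ,
      true_and] at hw
    simp only [hT]
    have hy0 := y.ne_zero
    have e1 : Algebra.trace F E ((s : E) * (-(algebraMap F E (z / (c * D'))
                * ((t * s : Eˣ) : E) ^ Fintype.card F) - algebraMap F E (z / c')))
        = -(y / c * Algebra.trace F E (t : E)) - z / c' * Algebra.trace F E (s : E) := by
      have : (s : E) * (-(algebraMap F E (z / (c * D'))
                * ((t * s : Eˣ) : E) ^ Fintype.card F) - algebraMap F E (z / c'))
          = -((z / (c * D') * Algebra.norm F (s : E)) • (t : E) ^ Fintype.card F)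
            - (z / c') • (s : E) := by
        rw [Algebra.smul_def, Algebra.smul_def, map_mul, ← mul_conj hE, Units.val_mul]
        ring
      rw [this, map_sub, map_neg, map_smul, map_smul, trace_conj hE, hw.2, smul_eq_mul,
        smul_eq_mul]
      field_simp
    rw [e1, hw.2, Units.val_mul, map_mul]
    have e2 : ψ ((a * x + d * y) / c) * ψ ((a' * y + d' * z) / c') *
          (Λ t * ψ (-(y / c * Algebra.trace F E (t : E))) *
          (Λ s * ψ (-(z / c' * Algebra.trace F E (s : E)))))
        = Λ t * Λ s * (ψ ((a * x + d * y) / c) * ψ ((a' * y + d' * z) / c') *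
          (ψ (-(y / c * Algebra.trace F E (t : E))) *
          ψ (-(z / c' * Algebra.trace F E (s : E))))) := by ring
    have e3 : ∀ u v : ℂ, ψ (a * x / c + d' * z / c') * (u * v)
        = u * (ψ (a * x / c + d' * z / c') * v) := by intro u v; ring
    rw [e2, e3]
    simp only [← AddChar.map_add_eq_mul]
    congr 2
    field_simp
    ring

theorem kirillovKernel_mul_generic (hE : Module.finrank F E = 2)
    {ψ : AddChar F ℂ} (hψ : ψ ≠ 1) {Λ : MulChar E ℂ} (hΛ : Λ ^ Fintype.card F ≠ Λ)
    {a b c d : F} (hc : c ≠ 0)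
    {a' b' c' d' : F} (hc' : c' ≠ 0) (h' : a' * d' - b' * c' ≠ 0) :
    kirillovKernel ψ Λ a b c d * kirillovKernel ψ Λ a' b' c' d'
      = kirillovKernel ψ Λ (a * a' + b * c') (a * b' + b * d')
          (c * a' + d * c') (c * b' + d * d') := by
  ext x z
  rw [kirillovKernel_mul_aux hE ψ hΛ hc hc' h']
  have hx0 := x.ne_zero
  have hz0 := z.ne_zero
  have hq : (Fintype.card F : ℂ) ≠ 0 := by exact_mod_cast Fintype.card_ne_zero
  set D := a * d - b * c with hD
  set D' := a' * d' - b' * c' with hD'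
  by_cases hC : c * a' + d * c' = 0
  · have hd : c * b' + d * d' = -(c * D' / c') := by
      rw [hD']; field_simp; linear_combination d' * hC
    set d₂ := c * b' + d * d' with hd₂
    have hd₂0 : d₂ ≠ 0 := by
      rw [hd]; exact neg_ne_zero.2 (div_ne_zero (mul_ne_zero hc h') hc')
    have hdet : D * D' = (a * a' + b * c') * d₂ := by
      rw [hD, hD', hd₂]; linear_combination -(a * b' + b * d') * hC
    have hβ : ∀ r : Eˣ, -(algebraMap F E (z / (c * D')) * (r : E) ^ Fintype.card F)
        - algebraMap F E (z / c') = 0 ↔ (r : E) = algebraMap F E d₂ := by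
      intro r
      have hp : algebraMap F E (z / (c * D')) ≠ 0 := by
        simpa using ⟨hc, h'⟩
      have e : algebraMap F E (z / c')
          = -(algebraMap F E (z / (c * D')) * algebraMap F E d₂) := by
        rw [← map_mul, ← map_neg, hd]
        congr 1
        field_simp
      rw [e, sub_neg_eq_add, neg_add_eq_zero, mul_right_inj' hp]
      constructor
      · intro h
        rw [← conj_conj (F := F) hE (r : E), h, ← map_pow, FiniteField.pow_card]
      · intro h
        rw [h, ← map_pow, FiniteField.pow_card]
    have hsum : ∀ r : Eˣ,
        ∑ s : E, ψ ((c * a' + d * c') / (c * c') * z / D' * Algebra.norm F s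
            + Algebra.trace F E (s * (-(algebraMap F E (z / (c * D'))
                * (r : E) ^ Fintype.card F) - algebraMap F E (z / c'))))
        = if (r : E) = algebraMap F E d₂ then (Fintype.card F : ℂ) ^ 2 else 0 := by
      intro r
      simp only [hC, zero_div, zero_mul, zero_add]
      rw [sum_trace hE hψ]
      simp only [hβ]
    simp only [hsum]
    by_cases hxz : (a * a' + b * c') * x = d₂ * z
    · rw [kirillovKernel_of_eq ψ Λ hC hxz]
      have hr0 : algebraMap F E d₂ ≠ 0 := by simpa using hd₂0
      rw [Finset.sum_eq_single (Units.mk0 _ hr0)]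
      rotate_left
      · intro r _ hr
        rw [if_neg, mul_zero]
        intro h
        exact hr (Units.ext h)
      · intro hn
        exfalso
        apply hn
        rw [mem_normFibre, Units.val_mk0, Algebra.norm_algebraMap, hE, mul_assoc, hdet]
        field_simp
        linear_combination -hxz
      rw [Units.val_mk0, if_pos rfl]
      have hph : ψ (a * x / c + d' * z / c') = ψ ((a * b' + b * d') * x / d₂) := by
        congr 1
        have hz : (z : F) = (a * a' + b * c') * x / d₂ := by
          field_simp; linear_combination -hxz
        rw [hz]
        field_simp
        rw [hd₂]
        linear_combination (a * d') * hC
      rw [hph]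
      field_simp
    · rw [kirillovKernel_of_ne ψ Λ hC hxz]
      rw [Finset.sum_eq_zero, mul_zero]
      intro r hr
      rw [if_neg, mul_zero]
      intro h
      apply hxz
      rw [mem_normFibre, h, Algebra.norm_algebraMap, hE, mul_assoc, hdet] at hr
      field_simp at hr
      linear_combination -hr
  · rw [kirillovKernel_of_ne_zero ψ Λ hC, Finset.mul_sum, Finset.mul_sum]
    have hdet : x / z * D * D' = x / z * ((a * a' + b * c') * (c * b' + d * d')
        - (a * b' + b * d') * (c * a' + d * c')) := by rw [hD, hD']; ring
    rw [← hdet]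
    refine Finset.sum_congr rfl fun r hr => ?_
    rw [mem_normFibre] at hr
    set C := c * a' + d * c' with hCdef
    have hα : C / (c * c') * z / D' ≠ 0 :=
      div_ne_zero (mul_ne_zero (div_ne_zero hC (mul_ne_zero hc hc')) hz0) h'
    rw [sum_norm_trace hE hψ hα]
    have hN : Algebra.norm F (-(algebraMap F E (z / (c * D')) * (r : E) ^ Fintype.card F)
        - algebraMap F E (z / c')) = (z / (c * D')) ^ 2 * (x / z * D * D')
          + z / (c * D') * (z / c') * Algebra.trace F E (r : E) + (z / c') ^ 2 := by
      have e : ∀ u v : E, -u - v = -(u + v) := fun u v => by ring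
      have e1 : Algebra.norm F (-1 : E) = 1 := by
        have := Algebra.norm_algebraMap (S := E) (-1 : F)
        rw [hE] at this
        simpa using this
      have e2 : algebraMap F E (z / (c * D')) * (r : E) ^ Fintype.card F
          * (algebraMap F E (z / c')) ^ Fintype.card F
          = (z / (c * D') * (z / c')) • (r : E) ^ Fintype.card F := by
        rw [← map_pow, FiniteField.pow_card, Algebra.smul_def, map_mul]; ring
      rw [e, neg_eq_neg_one_mul, map_mul, e1, one_mul, norm_add_eq hE, e2, map_smul,
        trace_conj hE, map_mul, norm_conj, hr, Algebra.norm_algebraMap, Algebra.norm_algebraMap,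
        hE, smul_eq_mul]
    rw [hN]
    have hph : ψ (a * x / c + d' * z / c') * ψ (-(((z / (c * D')) ^ 2 * (x / z * D * D')
          + z / (c * D') * (z / c') * Algebra.trace F E (r : E) + (z / c') ^ 2)
            / (C / (c * c') * z / D')))
        = ψ (((a * a' + b * c') * x + (c * b' + d * d') * z) / C)
          * ψ (-(z / C * Algebra.trace F E (r : E))) := by
      rw [← AddChar.map_add_eq_mul, ← AddChar.map_add_eq_mul]
      congr 1
      field_simp
      rw [hCdef, hD, hD']
      ring
    have e4 : ∀ u v w k : ℂ, (Fintype.card F : ℂ)⁻¹ ^ 2 * u * (v * (-(Fintype.card F : ℂ) * w))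
        = -(Fintype.card F : ℂ)⁻¹ * v * (u * w) := by
      intro u v w k
      field_simp
    rw [e4 _ _ _ 0, hph]
    ring

/-- The Kirillov matrices multiply. -/
theorem kirillovKernel_mul (hE : Module.finrank F E = 2)
    {ψ : AddChar F ℂ} (hψ : ψ ≠ 1) {Λ : MulChar E ℂ} (hΛ : Λ ^ Fintype.card F ≠ Λ)
    {a b c d : F} (h : a * d - b * c ≠ 0)
    {a' b' c' d' : F} (h' : a' * d' - b' * c' ≠ 0) :
    kirillovKernel ψ Λ a b c d * kirillovKernel ψ Λ a' b' c' d'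
      = kirillovKernel ψ Λ (a * a' + b * c') (a * b' + b * d')
          (c * a' + d * c') (c * b' + d * d') := by
  by_cases hc : c = 0
  · subst hc
    have had : a * d ≠ 0 := by simpa using h
    rw [kirillovKernel_mul_upper_left hE ψ Λ (left_ne_zero_of_mul had)
      (right_ne_zero_of_mul had) h']
    simp
  · by_cases hc' : c' = 0
    · subst hc'
      have had : a' * d' ≠ 0 := by simpa using h'
      rw [kirillovKernel_mul_upper_right hE ψ Λ hc (left_ne_zero_of_mul had)
        (right_ne_zero_of_mul had)]
      simp
    · exact kirillovKernel_mul_generic hE hψ hΛ hc hc' h'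

/-- The cuspidal representation of `GL (2, F)` attached to a character `Λ` of `Eˣ` with
`Λ ^ q ≠ Λ`, in its Kirillov model with respect to the nontrivial additive character `ψ`. It has
dimension `q - 1`, and up to isomorphism it does not depend on `ψ`. Its character takes the values
`(q - 1) * Λ x` at scalars `x`, `-Λ x` at the products of `x` and a nontrivial unipotent, `0` at
elements with two distinct eigenvalues in `F`, and `-(Λ z + Λ (z ^ q))` at elements with an
eigenvalue `z` in `E` outside `F`. -/
noncomputable def cuspidalRep (hE : Module.finrank F E = 2)
    {ψ : AddChar F ℂ} (hψ : ψ ≠ 1) {Λ : MulChar E ℂ} (hΛ : Λ ^ Fintype.card F ≠ Λ) :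
    Representation ℂ (GL (Fin 2) F) (Fˣ → ℂ) where
  toFun g := Matrix.toLin' (kirillovKernel ψ Λ (g 0 0) (g 0 1) (g 1 0) (g 1 1))
  map_one' := by
    have := kirillovKernel_one ψ Λ
    simp [this, Module.End.one_eq_id]
  map_mul' g h := by
    have hd : ∀ g : GL (Fin 2) F, g 0 0 * g 1 1 - g 0 1 * g 1 0 ≠ 0 := by
      intro g
      rw [← Matrix.det_fin_two]
      exact ((Matrix.isUnit_iff_isUnit_det _).1 g.isUnit).ne_zero
    rw [Module.End.mul_eq_comp, ← Matrix.toLin'_mul, kirillovKernel_mul hE hψ hΛ (hd g) (hd h)]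
    simp [Matrix.mul_apply, Fin.sum_univ_two]

end Fields

section Spherical

/-- The averaging operator `f ↦ P_Φ f`, where
`(P_Φ f) g = |K|⁻¹ * ∑ k ∈ K, Φ⁻¹ k * f (k * g)`. -/
noncomputable def sphericalAverage {G : Type*} [Group G] (K : Subgroup G) [Fintype K]
    (Φ : K →* ℂˣ) (f : G → ℂ) (g : G) : ℂ :=
  (Fintype.card K : ℂ)⁻¹ * ∑ k : K, ((Φ k)⁻¹ : ℂˣ) * f (k * g)

variable {F E : Type*} [Field F] [Fintype F] [DecidableEq F]
  [Field E] [Fintype E] [DecidableEq E] [Algebra F E]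

/-- The Coxeter torus `K` of `GL (2, F)`: the matrices, in the basis `b` of `E` over `F`, of the
multiplications by the elements of `Eˣ`. -/
noncomputable abbrev coxeterTorus (b : Module.Basis (Fin 2) F E) : Subgroup (GL (Fin 2) F) :=
  (Units.map (Algebra.leftMulMatrix b : E →* Matrix (Fin 2) (Fin 2) F)).range

/-- The spherical function `ζ^Φ_Λ = P_Φ χ_Λ` of `GL (2, F)` with respect to `K` and `Φ` that
is associated to the cuspidal character `χ_Λ`. -/
noncomputable def cuspidalSphericalFunction (b : Module.Basis (Fin 2) F E)
    (hE : Module.finrank F E = 2) {ψ : AddChar F ℂ} (hψ : ψ ≠ 1)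
    {Λ : MulChar E ℂ} (hΛ : Λ ^ Fintype.card F ≠ Λ) (Φ : coxeterTorus b →* ℂˣ) :
    GL (Fin 2) F → ℂ :=
  sphericalAverage (coxeterTorus b) Φ (cuspidalRep hE hψ hΛ).character

/-- The matrix `d(a, 1)`. -/
def diagOne (a : Fˣ) : GL (Fin 2) F where
  val := !![(a : F), 0; 0, 1]
  inv := !![((a⁻¹ : Fˣ) : F), 0; 0, 1]
  val_inv := by simp [Matrix.one_fin_two]
  inv_val := by simp [Matrix.one_fin_two]

variable (F E) in
/-- The group `U` of elements of norm one of `E` over `F`. -/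
noncomputable abbrev normOne : Subgroup Eˣ :=
  (Units.map (Algebra.norm F : E →* F)).ker

variable (F E) in
/-- The homomorphism `z ↦ z / z̄ = z / z ^ q` from `Eˣ` to `U`. -/
noncomputable def divConj : Eˣ →* normOne F E where
  toFun z := ⟨z / z ^ Fintype.card F, by
    rw [MonoidHom.mem_ker, map_div, map_pow, div_eq_one]
    ext
    rw [Units.val_pow_eq_pow_val, FiniteField.pow_card]⟩
  map_one' := by ext; simp
  map_mul' z w := by
    ext
    simp only [mul_pow, mul_div_mul_comm, Subgroup.coe_mul]

open Classical in
/-- The sign character of the cyclic group `U` of even order: `1` at squares of elements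
of `U` and `-1` elsewhere. -/
noncomputable def signNormOne (u : normOne F E) : ℂ :=
  if IsSquare u then 1 else -1

end Spherical

end FinitePoincare

namespace FinitePoincare

/-! The Kirillov kernel gives the cuspidal character at a matrix `g` with nonzero lower-left entry
as `-∑ Λ t`, over the `t` in `Eˣ` with norm `det g` and trace `tr g` (`trace_kirillovKernel`). For
`a ≠ 1` the same formula holds at every product of an element of the torus and `d(a, 1)`
(`character_coxeterTorus_mul_diagOne`). The average over the torus is thus a double sum over `z`
(the torus) and `t`.

Exchange the sums and fix `t`. The conditions prescribe the norm and the trace of `z`, so the number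
of solutions is `1 - ε(disc)`, with `disc` the discriminant of a quadratic polynomial. Up to a
nonzero square, `disc` is `N(t) * (Tr(t / t̄) - (a + a⁻¹))` (`card_norm_trace_diagOne`).

The constant `1` contributes `∑ Λ t = 0`, since `Λ` is not fixed by Frobenius. In the remaining term
`ε(N t)` is the sign character of `U` at `t / t̄` (`quadraticChar_norm`) and `Λ t = ω(t / t̄)`, so
the summand depends on `t / t̄` alone. By Hilbert 90, `t ↦ t / t̄` maps `Eˣ` onto `U` with fibres
the cosets of `Fˣ`. The resulting factor `q - 1` turns `|K|⁻¹ = (q² - 1)⁻¹` into `(q + 1)⁻¹`. -/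

variable {F E : Type*} [Field F] [Fintype F] [DecidableEq F]
  [Field E] [Fintype E] [DecidableEq E] [Algebra F E]

/-! ### Traces in the Kirillov model -/

/-- The trace of the operator of a non-upper-triangular matrix: minus the sum of `Λ` over the
roots in `Eˣ`, counted once each, of the characteristic polynomial. -/
theorem trace_kirillovKernel {ψ : AddChar F ℂ} (hψ : ψ ≠ 1) {Λ : MulChar E ℂ}
    (hΛ : Λ ^ Fintype.card F ≠ Λ) {a b c d : F} (hc : c ≠ 0) :
    (kirillovKernel ψ Λ a b c d).trace
      = -∑ t ∈ normFibre (E := E) (a * d - b * c),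
          if Algebra.trace F E (t : E) = a + d then Λ t else 0 := by
  have hq : (Fintype.card F : ℂ) ≠ 0 := by exact_mod_cast Fintype.card_ne_zero
  -- Orthogonality over all of `F`; the missing term `x = 0` accounts for the `-1`.
  have hsum : ∀ T : F, ∑ x : Fˣ, ψ (x * T)
      = (if T = 0 then (Fintype.card F : ℂ) else 0) - 1 := by
    intro T
    rw [sum_units fun x : F => ψ (x * T), AddChar.sum_mulShift _ (.of_ne_one hψ)]
    simp
  -- On the diagonal the quotient `x / y` is `1`, so the norm fibre no longer depends on `x` and the
  -- two sums can be exchanged.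
  have hdiag : ∀ x : Fˣ, kirillovKernel ψ Λ a b c d x x
      = ∑ t ∈ normFibre (E := E) (a * d - b * c), -(Fintype.card F : ℂ)⁻¹ * Λ t *
          ψ (x * ((a + d - Algebra.trace F E (t : E)) / c)) := by
    intro x
    rw [kirillovKernel_of_ne_zero ψ Λ hc, div_self x.ne_zero, one_mul, Finset.mul_sum]
    refine Finset.sum_congr rfl fun t _ => ?_
    have : (x : F) * ((a + d - Algebra.trace F E (t : E)) / c)
        = (a * x + d * x) / c + -(x / c * Algebra.trace F E (t : E)) := by
      field_simp
      ring
    rw [this, AddChar.map_add_eq_mul]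
    ring
  simp only [Matrix.trace, Matrix.diag, hdiag]
  rw [Finset.sum_comm]
  simp only [← Finset.mul_sum, hsum]
  have hterm : ∀ t : Eˣ, -(Fintype.card F : ℂ)⁻¹ * Λ t *
      ((if (a + d - Algebra.trace F E (t : E)) / c = 0 then (Fintype.card F : ℂ) else 0) - 1)
      = -(if Algebra.trace F E (t : E) = a + d then Λ t else 0)
        + (Fintype.card F : ℂ)⁻¹ * Λ t := by
    intro t
    have : (a + d - Algebra.trace F E (t : E)) / c = 0 ↔ Algebra.trace F E (t : E) = a + d := by
      rw [div_eq_zero_iff, or_iff_left hc, sub_eq_zero, eq_comm]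
    simp only [this]
    split_ifs
    · field_simp
      ring
    · ring
  simp only [hterm]
  -- The terms coming from `-1` add up to a multiple of the sum of `Λ` over a norm fibre, which is
  -- zero.
  rw [Finset.sum_add_distrib, ← Finset.mul_sum, sum_norm_fibre_eq_zero hΛ, mul_zero, add_zero,
    Finset.sum_neg_distrib]

/-- A character of `E` that is not fixed by Frobenius sums to zero. -/
theorem sum_units_eq_zero {Λ : MulChar E ℂ} (hΛ : Λ ^ Fintype.card F ≠ Λ) :
    ∑ t : Eˣ, Λ t = 0 := by
  rw [← Finset.sum_fiberwise Finset.univ fun t : Eˣ => Algebra.norm F (t : E)]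
  exact Finset.sum_eq_zero fun n _ => sum_norm_fibre_eq_zero hΛ n

/-! ### Coordinates in the basis `(1, δ)` and elements of given norm and trace -/

section Coordinates

variable (b : Module.Basis (Fin 2) F E)

theorem eq_repr_add (hb0 : b 0 = 1) (z : E) :
    z = algebraMap F E (b.repr z 0) + algebraMap F E (b.repr z 1) * b 1 := by
  conv_lhs => rw [← b.sum_repr z]
  simp [Fin.sum_univ_two, hb0, Algebra.smul_def]

theorem repr_algebraMap_add (hb0 : b 0 = 1) (x y : F) :
    b.repr (algebraMap F E x + algebraMap F E y * b 1) 0 = x ∧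
      b.repr (algebraMap F E x + algebraMap F E y * b 1) 1 = y := by
  have : algebraMap F E x + algebraMap F E y * b 1 = x • b 0 + y • b 1 := by
    simp [hb0, Algebra.smul_def]
  rw [this]
  simp

theorem conj_eq_neg_of_trace_eq_zero (hE : Module.finrank F E = 2) {t : E}
    (ht : Algebra.trace F E t = 0) : t ^ Fintype.card F = -t := by
  have := FiniteField.algebraMap_trace_eq_sum_pow F E t
  rw [ht, map_zero, hE] at this
  simp only [Finset.sum_range_succ, Finset.sum_range_zero, Nat.card_eq_fintype_card, pow_zero,
    pow_one] at this
  linear_combination -this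

theorem sq_basis_one (hE : Module.finrank F E = 2) (hb1 : Algebra.trace F E (b 1) = 0) :
    b 1 * b 1 = algebraMap F E (-Algebra.norm F (b 1)) := by
  have := mul_conj (F := F) hE (b 1)
  rw [conj_eq_neg_of_trace_eq_zero hE hb1] at this
  rw [map_neg]
  linear_combination -this

/-- Since `δ² = -N(δ)`, a square root `s` of `-N(δ)` in `F` would give `δ = ± s`, against the
independence of `1` and `δ`. -/
theorem not_isSquare_neg_norm_basis (hE : Module.finrank F E = 2) (hb0 : b 0 = 1)
    (hb1 : Algebra.trace F E (b 1) = 0) : ¬ IsSquare (-Algebra.norm F (b 1)) := by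
  rintro ⟨s, hs⟩
  have h := sq_basis_one b hE hb1
  rw [hs, map_mul] at h
  have key : ∀ r : F, b 1 ≠ algebraMap F E r := by
    intro r hr
    have h1 := (repr_algebraMap_add b hb0 r 0).2
    rw [map_zero, zero_mul, add_zero, ← hr] at h1
    simp at h1
  rcases mul_self_eq_mul_self_iff.1 h with h | h
  · exact key s h
  · exact key (-s) (by rw [h, map_neg])

theorem trace_eq_two_mul_repr (hE : Module.finrank F E = 2) (hb0 : b 0 = 1)
    (hb1 : Algebra.trace F E (b 1) = 0) (z : E) :
    Algebra.trace F E z = 2 * b.repr z 0 := by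
  conv_lhs => rw [eq_repr_add b hb0 z]
  rw [map_add, Algebra.trace_algebraMap, hE, ← Algebra.smul_def, map_smul, hb1]
  simp

theorem norm_eq_repr_sq (hE : Module.finrank F E = 2) (hb0 : b 0 = 1)
    (hb1 : Algebra.trace F E (b 1) = 0) (z : E) :
    Algebra.norm F z = b.repr z 0 ^ 2 + Algebra.norm F (b 1) * b.repr z 1 ^ 2 := by
  conv_lhs => rw [eq_repr_add b hb0 z]
  rw [norm_add_eq hE, mul_pow, conj_eq_neg_of_trace_eq_zero hE hb1, ← map_pow, FiniteField.pow_card,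
    map_mul (Algebra.norm F), Algebra.norm_algebraMap, Algebra.norm_algebraMap, hE]
  have : algebraMap F E (b.repr z 0) * (algebraMap F E (b.repr z 1) * -b 1)
      = (-(b.repr z 0 * b.repr z 1)) • b 1 := by
    rw [Algebra.smul_def, map_neg, map_mul]
    ring
  rw [this, map_smul, hb1]
  simp [mul_comm]

/-- The trace forces `z = T / 2 + y δ`, and the norm then fixes `y²`. Its quadratic class is
opposite to that of `T² - 4n`, because `-N(δ)` is not a square. A zero discriminant gives the single
solution `y = 0`, in accordance with `ε(0) = 0`. The condition `n ≠ 0` makes every solution a unit.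
-/
theorem card_norm_trace_fibre (hE : Module.finrank F E = 2) (hF : ringChar F ≠ 2)
    (hb0 : b 0 = 1) (hb1 : Algebra.trace F E (b 1) = 0) {n : F} (hn : n ≠ 0) (T : F) :
    (((normFibre (E := E) n).filter fun z : Eˣ => Algebra.trace F E (z : E) = T).card : ℤ)
      = 1 - quadraticChar F (T ^ 2 - 4 * n) := by
  have h2 : (2 : F) ≠ 0 := Ring.two_ne_zero hF
  have hns := not_isSquare_neg_norm_basis b hE hb0 hb1
  set m : F := Algebra.norm F (b 1) with hm
  have hm0 : m ≠ 0 := by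
    intro h
    apply hns
    simp [h]
  have hmq : quadraticChar F (-m) = -1 := quadraticChar_neg_one_iff_not_isSquare.2 hns
  -- The argument is `(4n - T²) / (4m)`, the required value of `y²`, factored so that the character
  -- of each factor is visible.
  have hcard := quadraticChar_card_sqrts hF ((T ^ 2 - 4 * n) * (-m) * ((2 * m)⁻¹) ^ 2)
  rw [map_mul, map_mul, quadraticChar_sq_one' (inv_ne_zero (mul_ne_zero h2 hm0)), hmq] at hcard
  rw [show 1 - quadraticChar F (T ^ 2 - 4 * n)
    = quadraticChar F (T ^ 2 - 4 * n) * -1 * 1 + 1 by ring, ← hcard]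
  congr 1
  refine Finset.card_bij (fun z _ => b.repr (z : E) 1) ?_ ?_ ?_
  · intro z hz
    rw [Finset.mem_filter, mem_normFibre, norm_eq_repr_sq b hE hb0 hb1,
      trace_eq_two_mul_repr b hE hb0 hb1] at hz
    obtain ⟨h, rfl⟩ := hz
    simp only [Set.mem_toFinset, Set.mem_ofPred_eq]
    rw [← h]
    field_simp
    ring
  · intro z hz w hw h
    rw [Finset.mem_filter, trace_eq_two_mul_repr b hE hb0 hb1] at hz hw
    have h0 : b.repr (z : E) 0 = b.repr (w : E) 0 :=
      mul_left_cancel₀ h2 (hz.2.trans hw.2.symm)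
    apply Units.ext
    rw [eq_repr_add b hb0 z, eq_repr_add b hb0 w, h0, h]
  · intro y hy
    simp only [Set.mem_toFinset, Set.mem_ofPred_eq] at hy
    set z : E := algebraMap F E (T / 2) + algebraMap F E y * b 1 with hz
    obtain ⟨hz0, hz1⟩ := repr_algebraMap_add b hb0 (T / 2) y
    have hN : Algebra.norm F z = n := by
      rw [norm_eq_repr_sq b hE hb0 hb1, hz0, hz1, ← hm, hy]
      field_simp
      ring
    have hzne : z ≠ 0 := by
      intro h
      rw [h, Algebra.norm_zero] at hN
      exact hn hN.symm
    refine ⟨Units.mk0 z hzne, ?_, hz1⟩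
    rw [Finset.mem_filter, mem_normFibre, Units.val_mk0, trace_eq_two_mul_repr b hE hb0 hb1, hz0]
    exact ⟨hN, by field_simp⟩

end Coordinates

/-! ### The group `U` and the map `z ↦ z / z̄` -/

section NormOne

theorem divConj_coe (z : Eˣ) :
    ((divConj F E z : Eˣ) : E) = z / (z : E) ^ Fintype.card F := by
  simp [divConj]

/-- An element fixed by conjugation is half its trace, hence lies in `F`; this is where `2` must be
invertible. -/
theorem divConj_eq_one_iff (hE : Module.finrank F E = 2) (hF : ringChar F ≠ 2) {z : Eˣ} :
    divConj F E z = 1 ↔ ∃ x : Fˣ, Units.map (algebraMap F E : F →* E) x = z := by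
  have hz : divConj F E z = 1 ↔ (z : E) ^ Fintype.card F = z := by
    rw [← Subtype.coe_inj, ← Units.val_inj, divConj_coe, Subgroup.coe_one, Units.val_one,
      div_eq_one_iff_eq (pow_ne_zero _ z.ne_zero), eq_comm]
  rw [hz]
  constructor
  · intro h
    have h2 : (2 : F) ≠ 0 := Ring.two_ne_zero hF
    have hT := FiniteField.algebraMap_trace_eq_sum_pow F E (z : E)
    rw [hE] at hT
    simp only [Finset.sum_range_succ, Finset.sum_range_zero, Nat.card_eq_fintype_card, pow_zero,
      pow_one, h] at hT
    have hz : algebraMap F E (Algebra.trace F E (z : E) / 2) = z := by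
      have h2' : (2 : E) ≠ 0 := by
        rw [← map_ofNat (algebraMap F E) 2]
        exact (map_ne_zero _).2 h2
      rw [map_div₀, hT, map_ofNat]
      field_simp
      ring
    have hx : Algebra.trace F E (z : E) / 2 ≠ 0 := by
      intro h0
      rw [h0, map_zero] at hz
      exact z.ne_zero hz.symm
    exact ⟨Units.mk0 _ hx, Units.ext hz⟩
  · rintro ⟨x, rfl⟩
    simp [← map_pow, FiniteField.pow_card]

/-- Hilbert 90 with explicit witnesses: `u ū = 1` gives `u = (1 + u) / (1 + ū)` when `u ≠ -1`, and
`-1 = δ / δ̄` because `δ` has trace zero. -/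
theorem divConj_surjective (hE : Module.finrank F E = 2) (b : Module.Basis (Fin 2) F E) (hb1 : Algebra.trace F E (b 1) = 0) :
    Function.Surjective (divConj F E) := by
  intro u
  have hu : ((u : Eˣ) : E) * ((u : Eˣ) : E) ^ Fintype.card F = 1 := by
    rw [mul_conj (F := F) hE]
    have := u.2
    rw [MonoidHom.mem_ker, ← Units.val_inj] at this
    have h : Algebra.norm F ((u : Eˣ) : E) = 1 := this
    rw [h, map_one]
  set v : E := ((u : Eˣ) : E) with hv
  have hadd : (1 + v) ^ Fintype.card F = 1 + v ^ Fintype.card F := by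
    simpa using map_add (FiniteField.frobeniusAlgHom F E) 1 v
  by_cases h : 1 + v = 0
  · have hb : b 1 ≠ 0 := b.ne_zero 1
    refine ⟨Units.mk0 (b 1) hb, ?_⟩
    rw [← Subtype.coe_inj, ← Units.val_inj, divConj_coe, Units.val_mk0,
      conj_eq_neg_of_trace_eq_zero hE hb1, div_neg, div_self hb]
    linear_combination -h
  · refine ⟨Units.mk0 (1 + v) h, ?_⟩
    rw [← Subtype.coe_inj, ← Units.val_inj, divConj_coe, Units.val_mk0,
      div_eq_iff (pow_ne_zero _ h), hadd]
    linear_combination -hu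

/-- Each fibre is a coset of the kernel `Fˣ`, so it has `q - 1` elements. -/
theorem sum_divConj (hE : Module.finrank F E = 2) (hF : ringChar F ≠ 2)
    (hsurj : Function.Surjective (divConj F E)) (f : normOne F E → ℂ) :
    ∑ z : Eˣ, f (divConj F E z) = ((Fintype.card F : ℂ) - 1) * ∑ u : normOne F E, f u := by
  classical
  rw [← Finset.sum_fiberwise Finset.univ (divConj F E), Finset.mul_sum]
  refine Finset.sum_congr rfl fun u _ => ?_
  have hcard : (Finset.univ.filter fun z : Eˣ => divConj F E z = u).card = Fintype.card Fˣ := by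
    obtain ⟨w, rfl⟩ := hsurj u
    symm
    refine Finset.card_bij (fun x _ => w * Units.map (algebraMap F E : F →* E) x) ?_ ?_ ?_
    · intro x _
      simp [(divConj_eq_one_iff hE hF).2 ⟨x, rfl⟩]
    · intro x _ y _ h
      exact Units.map_injective (algebraMap F E).injective (mul_left_cancel h)
    · intro z hz
      simp only [Finset.mem_filter_univ] at hz
      obtain ⟨x, hx⟩ := (divConj_eq_one_iff hE hF).1
        (show divConj F E (w⁻¹ * z) = 1 by rw [map_mul, map_inv, hz, inv_mul_cancel])
      exact ⟨x, Finset.mem_univ _, by rw [hx, mul_inv_cancel_left]⟩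
  rw [Finset.sum_congr rfl fun z hz => by rw [(Finset.mem_filter.1 hz).2], Finset.sum_const, hcard,
    Fintype.card_units, nsmul_eq_mul, Nat.cast_sub Fintype.card_pos, Nat.cast_one]

/-- `Λ` is trivial on the kernel `Fˣ` of a surjection onto `U`, so it factors through that
surjection in one way only. -/
theorem existsUnique_normOne_character (hE : Module.finrank F E = 2) (hF : ringChar F ≠ 2)
    (hsurj : Function.Surjective (divConj F E)) (Λ : MulChar E ℂ)
    (hΛF : ∀ x : Fˣ, Λ (algebraMap F E x) = 1) :
    ∃! ω : normOne F E →* ℂˣ, ∀ z : Eˣ, (ω (divConj F E z) : ℂ) = Λ z := by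
  have hker : (divConj F E).ker ≤ Λ.toUnitHom.ker := by
    intro z hz
    obtain ⟨x, rfl⟩ := (divConj_eq_one_iff hE hF).1 hz
    rw [MonoidHom.mem_ker, ← Units.val_inj, MulChar.coe_toUnitHom]
    exact hΛF x
  refine ⟨(divConj F E).liftOfSurjective hsurj ⟨Λ.toUnitHom, hker⟩, ?_, ?_⟩
  · intro z
    rw [MonoidHom.liftOfRightInverse_comp_apply, MulChar.coe_toUnitHom]
  · intro ω hω
    ext u
    obtain ⟨z, rfl⟩ := hsurj u
    rw [hω, MonoidHom.liftOfRightInverse_comp_apply, MulChar.coe_toUnitHom]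

/-- If `t / t̄ = (s / s̄)²`, then `t = x s²` with `x` in `F`, so `N(t) = (x N(s))²`. Conversely, if
`N(t) = c²`, then `v = t / c` has norm one, so `v̄ = v⁻¹` and `t / t̄ = v / v̄ = v²` is a square in
`U`. -/
theorem quadraticChar_norm (hE : Module.finrank F E = 2) (hF : ringChar F ≠ 2)
    (hsurj : Function.Surjective (divConj F E)) (t : Eˣ) :
    (quadraticChar F (Algebra.norm F (t : E)) : ℂ) = signNormOne (divConj F E t) := by
  have hN : Algebra.norm F (t : E) ≠ 0 := Algebra.norm_ne_zero_iff.2 t.ne_zero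
  have hiff : IsSquare (divConj F E t) ↔ IsSquare (Algebra.norm F (t : E)) := by
    constructor
    · rintro ⟨u, hu⟩
      obtain ⟨s, rfl⟩ := hsurj u
      obtain ⟨x, hx⟩ := (divConj_eq_one_iff hE hF).1
        (show divConj F E (t * (s * s)⁻¹) = 1 by
          rw [map_mul, map_inv, map_mul, hu, mul_inv_cancel])
      have : (t : E) = algebraMap F E x * (s * s) := by
        have := congrArg Units.val (eq_mul_inv_iff_mul_eq.1 hx)
        simpa using this.symm
      rw [this, map_mul, Algebra.norm_algebraMap, hE, map_mul]
      exact ⟨x * Algebra.norm F (s : E), by ring⟩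
    · rintro ⟨c, hc⟩
      have hc0 : c ≠ 0 := by
        rintro rfl
        simp only [mul_zero] at hc
        exact hN hc
      set x : Fˣ := Units.mk0 c hc0 with hx
      set v : Eˣ := t * Units.map (algebraMap F E : F →* E) x⁻¹ with hv
      have hv1 : divConj F E v = divConj F E t := by
        rw [hv, map_mul, (divConj_eq_one_iff hE hF).2 ⟨x⁻¹, rfl⟩, mul_one]
      have hvN : Algebra.norm F (v : E) = 1 := by
        have : (v : E) = t * algebraMap F E c⁻¹ := by simp [hv, hx]
        rw [this, map_mul, Algebra.norm_algebraMap, hE, hc]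
        field_simp
      have hvv : (v : E) * (v : E) ^ Fintype.card F = 1 := by
        rw [mul_conj (F := F) hE, hvN, map_one]
      refine ⟨⟨v, by rw [MonoidHom.mem_ker]; ext; exact hvN⟩, ?_⟩
      rw [← hv1, ← Subtype.coe_inj, ← Units.val_inj, divConj_coe]
      rw [div_eq_iff (pow_ne_zero _ v.ne_zero)]
      simp only [Subgroup.coe_mul, Units.val_mul]
      linear_combination -(v : E) * hvv
  rw [signNormOne]
  split_ifs with h
  · rw [(quadraticChar_one_iff_isSquare hN).2 (hiff.1 h), Int.cast_one]
  · rw [quadraticChar_neg_one_iff_not_isSquare.2 (mt hiff.2 h)]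
    simp

end NormOne

/-! ### The Coxeter torus and the cuspidal character on its translate by `d(a, 1)` -/

theorem leftMulMatrix_eq (hE : Module.finrank F E = 2) (b : Module.Basis (Fin 2) F E)
    (hb0 : b 0 = 1) (hb1 : Algebra.trace F E (b 1) = 0) (z : E) :
    Algebra.leftMulMatrix b z = !![b.repr z 0, -Algebra.norm F (b 1) * b.repr z 1;
      b.repr z 1, b.repr z 0] := by
  have hz1 : z * b 1 = algebraMap F E (-Algebra.norm F (b 1) * b.repr z 1)
      + algebraMap F E (b.repr z 0) * b 1 := by
    conv_lhs => rw [eq_repr_add b hb0 z]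
    rw [map_mul, ← sq_basis_one b hE hb1]
    ring
  obtain ⟨h0, h1⟩ := repr_algebraMap_add b hb0 (-Algebra.norm F (b 1) * b.repr z 1) (b.repr z 0)
  rw [← hz1] at h0 h1
  ext i j
  rw [Algebra.leftMulMatrix_eq_repr_mul]
  fin_cases i <;> fin_cases j <;> simp [hb0, h0, h1]

theorem sum_coxeterTorus (b : Module.Basis (Fin 2) F E) (f : GL (Fin 2) F → ℂ)
    [Fintype (coxeterTorus b)] :
    ∑ k : coxeterTorus b, f k
      = ∑ z : Eˣ, f (Units.map (Algebra.leftMulMatrix b : E →* Matrix (Fin 2) (Fin 2) F) z) := by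
  have hinj : Function.Injective
      (Units.map (Algebra.leftMulMatrix b : E →* Matrix (Fin 2) (Fin 2) F)) :=
    Units.map_injective (Algebra.leftMulMatrix_injective b)
  exact (Fintype.sum_equiv (MonoidHom.ofInjective hinj).toEquiv _ _ fun z => rfl).symm

theorem card_coxeterTorus (hE : Module.finrank F E = 2) (b : Module.Basis (Fin 2) F E)
    [Fintype (coxeterTorus b)] :
    (Fintype.card (coxeterTorus b) : ℂ) = (Fintype.card F : ℂ) ^ 2 - 1 := by
  have h := sum_coxeterTorus b fun _ => 1
  rw [sum_units fun _ : E => (1 : ℂ)] at h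
  simpa [Module.card_eq_pow_finrank (K := F) (V := E), hE] using h

/-- The value of the cuspidal character at the product of an element of the Coxeter torus and
`d(a, 1)`. -/
theorem character_coxeterTorus_mul_diagOne (hE : Module.finrank F E = 2)
    (b : Module.Basis (Fin 2) F E) (hb0 : b 0 = 1) (hb1 : Algebra.trace F E (b 1) = 0)
    {ψ : AddChar F ℂ} (hψ : ψ ≠ 1) {Λ : MulChar E ℂ} (hΛ : Λ ^ Fintype.card F ≠ Λ)
    {a : Fˣ} (ha : a ≠ 1) (z : Eˣ) :
    (cuspidalRep hE hψ hΛ).character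
        (Units.map (Algebra.leftMulMatrix b : E →* Matrix (Fin 2) (Fin 2) F) z * diagOne a)
      = -∑ t : Eˣ, if Algebra.norm F (t : E) = a * Algebra.norm F (z : E) ∧
          Algebra.trace F E (t : E) = (a + 1) * b.repr (z : E) 0 then Λ t else 0 := by
  have ha' : (a : F) ≠ 1 := by simpa using ha
  set x := b.repr (z : E) 0 with hx
  set y := b.repr (z : E) 1 with hy
  have hN := norm_eq_repr_sq b hE hb0 hb1 (z : E)
  rw [← hx, ← hy] at hN
  have hmat : ((Units.map (Algebra.leftMulMatrix b : E →* Matrix (Fin 2) (Fin 2) F) z * diagOne a :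
      GL (Fin 2) F) : Matrix (Fin 2) (Fin 2) F)
      = !![a * x, -Algebra.norm F (b 1) * y; a * y, x] := by
    rw [Units.val_mul, Units.coe_map, MonoidHom.coe_coe, leftMulMatrix_eq hE b hb0 hb1]
    simp [diagOne, ← hx, ← hy, mul_comm]
  have hrep : (cuspidalRep hE hψ hΛ).character
      (Units.map (Algebra.leftMulMatrix b : E →* Matrix (Fin 2) (Fin 2) F) z * diagOne a)
      = (kirillovKernel ψ Λ (a * x) (-Algebra.norm F (b 1) * y) (a * y) x).trace := by
    rw [Representation.character, cuspidalRep]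
    simp only [MonoidHom.coe_mk, OneHom.coe_mk, Matrix.trace_toLin'_eq, hmat]
    simp
  rw [hrep]
  -- Here `z` lies in `F` and the matrix is `diag(a x, x)`, outside the range of the trace formula.
  -- Both sides vanish: the eigenvalues differ as `a ≠ 1`, so the kernel is zero on the diagonal,
  -- and no `t` has the required norm and trace.
  by_cases hy0 : y = 0
  · have hx0 : x ≠ 0 := by
      intro hx0
      have hN0 : Algebra.norm F (z : E) ≠ 0 := Algebra.norm_ne_zero_iff.2 z.ne_zero
      apply hN0
      rw [hN, hx0, hy0]
      ring
    have hz : (z : E) = algebraMap F E x := by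
      rw [eq_repr_add b hb0 (z : E), ← hx, ← hy, hy0]
      simp
    have h1 : (kirillovKernel ψ Λ (a * x) (-Algebra.norm F (b 1) * y) (a * y) x).trace = 0 := by
      refine Finset.sum_eq_zero fun w _ => ?_
      rw [Matrix.diag, kirillovKernel_of_ne ψ Λ (by rw [hy0, mul_zero])]
      intro h
      exact ha' (mul_right_cancel₀ hx0 (by rw [mul_right_cancel₀ w.ne_zero h, one_mul]))
    rw [h1, Finset.sum_eq_zero, neg_zero]
    intro t _
    rw [if_neg]
    rintro ⟨hn, hT⟩
    have hn' : Algebra.norm F (t : E) = a * x ^ 2 := by rw [hn, hN, hy0]; ring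
    -- Such a `t` would be a root of the split characteristic polynomial, so `t = a x` or `t = x`.
    -- As an element of `F` it has norm `t²`, and either case of `t² = a x²` gives `a = 1`.
    have hroot : ((t : E) - algebraMap F E (a * x)) * (t - algebraMap F E x) = 0 := by
      have e1 := mul_conj (F := F) hE (t : E)
      have e2 := FiniteField.algebraMap_trace_eq_sum_pow F E (t : E)
      rw [hE] at e2
      simp only [Finset.sum_range_succ, Finset.sum_range_zero, Nat.card_eq_fintype_card, pow_zero,
        pow_one] at e2
      rw [hT] at e2
      rw [hn'] at e1
      simp only [map_mul, map_add, map_one, map_pow] at e1 e2 ⊢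
      linear_combination -(t : E) * e2 - e1
    have hcase : ∀ r : F, (t : E) = algebraMap F E r → r ^ 2 = a * x ^ 2 := by
      intro r hr
      rw [← hn', hr, Algebra.norm_algebraMap, hE]
    rcases mul_eq_zero.1 hroot with h | h
    · have h := hcase _ (sub_eq_zero.1 h)
      apply ha'
      apply mul_left_cancel₀ (mul_ne_zero a.ne_zero (pow_ne_zero 2 hx0))
      linear_combination h
    · have h := hcase _ (sub_eq_zero.1 h)
      apply ha'
      apply mul_right_cancel₀ (pow_ne_zero 2 hx0)
      linear_combination -h
  · rw [trace_kirillovKernel hψ hΛ (mul_ne_zero a.ne_zero hy0)]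
    have hdet : a * x * x - -Algebra.norm F (b 1) * y * (a * y) = a * Algebra.norm F (z : E) := by
      rw [hN]
      ring
    rw [hdet, normFibre, Finset.sum_filter]
    simp only [ite_and, add_mul, one_mul]

/-! ### Counting torus elements for a fixed eigenvalue -/

/-- As `a ≠ -1`, the conditions on `z` say that its norm is `N(t) / a` and its trace `2 Tr(t) / (a +
1)`, so `card_norm_trace_fibre` applies. It remains to compute the discriminant up to squares. -/
theorem card_norm_trace_diagOne (hE : Module.finrank F E = 2) (hF : ringChar F ≠ 2)
    (b : Module.Basis (Fin 2) F E) (hb0 : b 0 = 1) (hb1 : Algebra.trace F E (b 1) = 0)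
    {a : Fˣ} (ha : a ≠ -1) (t : Eˣ) :
    ((Finset.univ.filter fun z : Eˣ => Algebra.norm F (t : E) = a * Algebra.norm F (z : E) ∧
          Algebra.trace F E (t : E) = (a + 1) * b.repr (z : E) 0).card : ℤ)
      = 1 - quadraticChar F (Algebra.norm F (t : E)) *
        quadraticChar F (Algebra.trace F E ((divConj F E t : Eˣ) : E) - ((a : F) + (a : F)⁻¹)) := by
  have h2 : (2 : F) ≠ 0 := Ring.two_ne_zero hF
  have ha0 : (a : F) ≠ 0 := a.ne_zero
  have ha1 : (a : F) + 1 ≠ 0 := by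
    intro h
    exact ha (Units.ext (by rw [Units.val_neg, Units.val_one]; linear_combination h))
  set n := Algebra.norm F (t : E) with hn
  have hn0 : n ≠ 0 := Algebra.norm_ne_zero_iff.2 t.ne_zero
  set T := Algebra.trace F E (t : E) with hT
  set w := Algebra.trace F E ((divConj F E t : Eˣ) : E) with hw
  have htr : ∀ s : E, algebraMap F E (Algebra.trace F E s) = s + s ^ Fintype.card F := by
    intro s
    have e2 := FiniteField.algebraMap_trace_eq_sum_pow F E s
    rw [hE] at e2
    simpa [Finset.sum_range_succ] using e2
  -- `Tr(t)² = t² + 2 t t̄ + t̄²`; dividing by `n = t t̄` leaves `t / t̄ + t̄ / t + 2`.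
  have hTw : T ^ 2 = n * (w + 2) := by
    apply (algebraMap F E).injective
    rw [map_pow, map_mul, map_add, map_ofNat, hT, hw, htr, htr, hn, ← mul_conj (F := F) hE,
      divConj_coe, div_pow, conj_conj hE]
    have := t.ne_zero
    field_simp
    ring
  have hcard := card_norm_trace_fibre b hE hF hb0 hb1 (div_ne_zero hn0 ha0) (2 * T / (a + 1))
  -- The shift by `a + a⁻¹` arises from `w + 2 - (a + 1)² / a`.
  have hdisc : (2 * T / (a + 1)) ^ 2 - 4 * (n / a)
      = n * (w - ((a : F) + (a : F)⁻¹)) * (2 / (a + 1)) ^ 2 := by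
    rw [div_pow, mul_pow, hTw]
    field_simp
    ring
  rw [hdisc, map_mul, map_mul, quadraticChar_sq_one' (div_ne_zero h2 ha1), mul_one] at hcard
  rw [← hcard]
  congr 2
  ext z
  rw [Finset.mem_filter_univ, Finset.mem_filter, mem_normFibre, trace_eq_two_mul_repr b hE hb0 hb1,
    eq_div_iff ha0, eq_div_iff ha1, mul_comm _ (a : F), eq_comm]
  refine and_congr_right fun _ => ?_
  rw [show 2 * b.repr (z : E) 0 * (a + 1) = 2 * ((a + 1) * b.repr (z : E) 0) by ring,
    mul_right_inj' h2, eq_comm]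

end FinitePoincare

/-! ### The formula for the spherical function -/

open FinitePoincare in
theorem mainTheorem10 {F E : Type*} [Field F] [Fintype F] [DecidableEq F]
    [Field E] [Fintype E] [DecidableEq E] [Algebra F E]
    (hE : Module.finrank F E = 2) (hF : ringChar F ≠ 2)
    (b : Module.Basis (Fin 2) F E) (hb0 : b 0 = 1) (hb1 : Algebra.trace F E (b 1) = 0)
    (ψ : AddChar F ℂ) (hψ : ψ ≠ 1)
    (Λ : MulChar E ℂ) (hΛ : Λ ^ Fintype.card F ≠ Λ)
    (hΛF : ∀ x : Fˣ, Λ (algebraMap F E x) = 1) :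
    (∃! ω : normOne F E →* ℂˣ, ∀ z : Eˣ, (ω (divConj F E z) : ℂ) = Λ z) ∧
    ∀ ω : normOne F E →* ℂˣ, (∀ z : Eˣ, (ω (divConj F E z) : ℂ) = Λ z) →
      ∀ a : Fˣ, a ≠ 1 → a ≠ -1 →
        cuspidalSphericalFunction b hE hψ hΛ 1 (diagOne a)
          = ((Fintype.card F : ℂ) + 1)⁻¹ * ∑ u : normOne F E,
              (quadraticChar F (Algebra.trace F E ((u : Eˣ) : E) - ((a : F) + (a : F)⁻¹)) : ℂ)
                * (signNormOne u * (ω u : ℂ)) := by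
  have hsurj := divConj_surjective hE b hb1
  refine ⟨existsUnique_normOne_character hE hF hsurj Λ hΛF, fun ω hω a ha ha' => ?_⟩
  rw [cuspidalSphericalFunction, sphericalAverage, card_coxeterTorus hE b]
  simp only [MonoidHom.one_apply, inv_one, Units.val_one, one_mul]
  rw [sum_coxeterTorus b fun k => (cuspidalRep hE hψ hΛ).character (k * diagOne a)]
  simp only [character_coxeterTorus_mul_diagOne hE b hb0 hb1 hψ hΛ ha]
  rw [Finset.sum_neg_distrib, Finset.sum_comm]
  -- For fixed `t` the summand is constant, so the inner sum is `Λ t` times the number of admissible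
  -- `z`.
  have hterm : ∀ t : Eˣ, (∑ z : Eˣ, if Algebra.norm F (t : E) = a * Algebra.norm F (z : E) ∧
          Algebra.trace F E (t : E) = (a + 1) * b.repr (z : E) 0 then Λ t else 0)
      = Λ t - (quadraticChar F (Algebra.trace F E ((divConj F E t : Eˣ) : E)
          - ((a : F) + (a : F)⁻¹)) : ℂ)
            * (signNormOne (divConj F E t) * (ω (divConj F E t) : ℂ)) := by
    intro t
    have hcard := congrArg (Int.cast : ℤ → ℂ) (card_norm_trace_diagOne hE hF b hb0 hb1 ha' t)
    push_cast at hcard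
    rw [← Finset.sum_filter, Finset.sum_const, nsmul_eq_mul, hcard, quadraticChar_norm hE hF hsurj,
      hω]
    ring
  simp only [hterm]
  -- The main term `∑ Λ t` vanishes; the two minus signs cancel, and what is left is summed along
  -- the fibres over `U`.
  rw [Finset.sum_sub_distrib, sum_units_eq_zero hΛ, zero_sub, neg_neg,
    sum_divConj hE hF hsurj fun u => (quadraticChar F (Algebra.trace F E ((u : Eˣ) : E)
      - ((a : F) + (a : F)⁻¹)) : ℂ) * (signNormOne u * (ω u : ℂ)), ← mul_assoc]
  congr 1
  have hq : (Fintype.card F : ℂ) - 1 ≠ 0 := by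
    rw [sub_ne_zero]
    exact_mod_cast (Fintype.one_lt_card (α := F)).ne'
  have hq' : (Fintype.card F : ℂ) + 1 ≠ 0 := by exact Nat.cast_add_one_ne_zero _
  rw [show (Fintype.card F : ℂ) ^ 2 - 1
    = ((Fintype.card F : ℂ) - 1) * ((Fintype.card F : ℂ) + 1) by ring]
  field_simp
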